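/- Let $\mathcal X$ be a compact metric space, let $k:\mathcal X\times\mathcal X\to\mathbb R$ be a continuous, symmetric, positive semi-definite kernel, and let $H_k$ be its reproducing kernel Hilbert space, with inner product $\langle\cdot,\cdot\rangle$. Let $\nu$ be a Borel probability measure on $\mathcal X$ with full support such that $\int k(x,x)\,d\nu(x)<\infty$. A Gaussian random element (GRE) in $H_k$ is a Borel measurable map $F:\Omega\to H_k$, defined on a probability space $(\Omega,\mathcal A,\mathbb P)$, such that $\langle F,h\rangle$ is a (possibly degenerate) real Gaussian random variable for every $h\in H_k$. For $m\in H_k$ and a bounded linear operator $C:H_k\to H_k$, write $F\sim\mathcal N(m,C)$ if $F$ is a GRE with mean element $\int F\,d\mathbb P=m$ and covariance operator $C$, that is, $Ch=\int \langle F,h\rangle F\,d\mathbb P-\langle m,h\rangle m$ for all $h\in H_k$ (Bochner integrals). Then: 1. The formula $$(Cf)(x)=\int k(x,x')f(x')\,d\nu(x'),\qquad f\in H_k,\ x\in\mathcal X,$$ defines a bounded linear operator $C:H_k\to H_k$, and there exist a probability space and a Gaussian random element $F\sim\mathcal N(0,C)$ in $H_k$ defined on it. 2. For every Gaussian random element $F\sim\mathcal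 N(0,C)$ in $H_k$, on any probability space, the process $G=\{G(x):x\in\mathcal X\}$, $G(x):=\langle F,k(x,\cdot)\rangle$, is a Gaussian process with mean zero and covariance kernel $$r(x,x')=\int k(x,z)\,k(z,x')\,d\nu(z),\qquad x,x'\in\mathcal X.$$ -/

import Mathlib

open MeasureTheory ProbabilityTheory
open scoped InnerProductSpace

universe u v w

/-- A Gaussian random element in a real Hilbert space `H`: a measurable map `F : Ω → H` such that
`⟨F, h⟩` is a (possibly degenerate) real Gaussian random variable for every `h : H`. -/
structure IsGaussianRandomElement {Ω : Type v} [MeasurableSpace Ω] {H : Type w}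
    [NormedAddCommGroup H] [InnerProductSpace ℝ H] [MeasurableSpace H]
    (F : Ω → H) (P : Measure Ω) : Prop where
  measurable : Measurable F
  hasGaussianLaw_inner : ∀ h : H, HasGaussianLaw (fun ω ↦ ⟪F ω, h⟫_ℝ) P

/-- The mean element `𝔼[F] = ∫ F dP` (Bochner integral). -/
noncomputable def meanElement {Ω : Type v} [MeasurableSpace Ω] {H : Type w}
    [NormedAddCommGroup H] [InnerProductSpace ℝ H]
    (F : Ω → H) (P : Measure Ω) : H :=
  ∫ ω, F ω ∂P

/-- The covariance operator of a random element,
`h ↦ ∫ ⟨F, h⟩ F dP - ⟨m, h⟩ m` with `m = 𝔼[F]` (Bochner integral). -/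
noncomputable def covarianceOp {Ω : Type v} [MeasurableSpace Ω] {H : Type w}
    [NormedAddCommGroup H] [InnerProductSpace ℝ H]
    (F : Ω → H) (P : Measure Ω) (h : H) : H :=
  (∫ ω, ⟪F ω, h⟫_ℝ • F ω ∂P) - ⟪meanElement F P, h⟫_ℝ • meanElement F P

/-- `F ∼ 𝒩(m, C)`: `F` is a Gaussian random element with mean element `m` and covariance
operator `C`. -/
structure IsGREWith {Ω : Type v} [MeasurableSpace Ω] {H : Type w}
    [NormedAddCommGroup H] [InnerProductSpace ℝ H] [MeasurableSpace H]
    (F : Ω → H) (P : Measure Ω) (m : H) (C : H →L[ℝ] H) : Prop where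
  isGaussianRandomElement : IsGaussianRandomElement F P
  mean_eq : meanElement F P = m
  covariance_eq : ∀ h : H, covarianceOp F P h = C h

/-- `H` is the reproducing kernel Hilbert space of `k`: the representer in `H` of the evaluation
at `x` is the function `k(x, ·)`, for every `x`. -/
def IsRKHSOf {X : Type u} (H : Type w) [NormedAddCommGroup H] [InnerProductSpace ℝ H]
    [CompleteSpace H] [RKHS ℝ H X ℝ] (k : X → X → ℝ) : Prop :=
  ∀ x : X, ⇑(RKHS.kerFun H x (1 : ℝ)) = k x

/-- The kernel `r(x, x') = ∫ k(x, z) k(z, x') dν(z)`. -/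
noncomputable def smoothedKernel {X : Type u} [MeasurableSpace X] (k : X → X → ℝ) (ν : Measure X)
    (x x' : X) : ℝ :=
  ∫ z, k x z * k z x' ∂ν

/-- `G` is a centred Gaussian process with covariance kernel `r`. -/
structure IsCentredGPWithKernel {X : Type u} {Ω : Type v} [MeasurableSpace Ω]
    (G : X → Ω → ℝ) (P : Measure Ω) (r : X → X → ℝ) : Prop where
  isGaussianProcess : IsGaussianProcess G P
  mean_eq_zero : ∀ x, ∫ ω, G x ω ∂P = 0
  covariance_eq : ∀ x x', cov[G x, G x'; P] = r x x'

/-! Let `T` be the inclusion of the RKHS into `L²(ν)`. The reproducing property gives `C = T* T`,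
and `T` is Hilbert-Schmidt, since Bessel's inequality bounds `∑ b_i(x)²` by `k(x, x)`, which is
`ν`-integrable (`IsRKHSOf.summable_norm_toL2_sq`). With `e` a Hilbert basis of `L²(ν)` and `ξ`
i.i.d. standard Gaussian, `F = ∑ ξ_j T* e_j` converges in `L²(P; H)`; its one-dimensional
projections are `L²` limits of Gaussians, hence Gaussian, and Parseval identifies the covariance as
`T* T` (`exists_isGREWith_adjoint_comp`). The process claim follows from `⟪C k_x, k_y⟫ = r(x, y)`,
where `k_x = k(x, ·)`. -/

/-! ### Real Gaussian variables in `L²`. -/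

theorem L2.integral_const_mul_eq_inner {Ω : Type*} [MeasurableSpace Ω] {P : Measure Ω}
    [IsFiniteMeasure P] (c : ℝ) (u : Lp ℝ 2 P) : ∫ ω, c * u ω ∂P = ⟪Lp.const 2 P c, u⟫_ℝ := by
  rw [L2.inner_def]
  refine integral_congr_ae ?_
  filter_upwards [Lp.coeFn_const (p := 2) (μ := P) c] with ω hω
  rw [hω]
  simp [mul_comm]

theorem Lp.coeFn_sum_smul {Ω κ : Type*} [MeasurableSpace Ω] {P : Measure Ω}
    (f : κ → Lp ℝ 2 P) (c : κ → ℝ) (s : Finset κ) :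
    (∑ i ∈ s, c i • f i : Lp ℝ 2 P) =ᵐ[P] fun ω ↦ ∑ i ∈ s, c i * f i ω := by
  classical
  induction s using Finset.induction_on with
  | empty => simpa using! Lp.coeFn_zero ℝ 2 P
  | insert j s hj ih =>
    rw [Finset.sum_insert hj]
    filter_upwards [Lp.coeFn_add (c j • f j) (∑ i ∈ s, c i • f i), Lp.coeFn_smul (c j) (f j), ih]
      with ω h1 h2 h3
    rw [h1, Pi.add_apply, h2, h3, Finset.sum_insert hj, Pi.smul_apply, smul_eq_mul]

open Filter Topology in
/-- The real Gaussian random variables form a closed subset of `L²`. -/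
theorem isClosed_setOf_hasGaussianLaw {Ω : Type*} [MeasurableSpace Ω] (P : Measure Ω)
    [IsProbabilityMeasure P] : IsClosed {f : Lp ℝ 2 P | HasGaussianLaw f P} := by
  refine IsSeqClosed.isClosed fun f g hf h ↦ ?_
  change ∀ i, HasGaussianLaw (f i) P at hf
  change HasGaussianLaw g P
  -- `L²` convergence makes the characteristic functions, means and variances all converge, so the
  -- limit keeps the Gaussian form, possibly degenerate.
  have hd : TendstoInDistribution (fun i ↦ (f i : Ω → ℝ)) atTop g (fun _ ↦ P) P :=
    (tendstoInMeasure_of_tendsto_Lp h).tendstoInDistribution fun i ↦ (hf i).aemeasurable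
  have hg : AEMeasurable g P := (Lp.aestronglyMeasurable g).aemeasurable
  have hmean (c : ℝ) : Tendsto (fun i ↦ ∫ ω, c * f i ω ∂P) atTop (𝓝 (∫ ω, c * g ω ∂P)) := by
    simp_rw [L2.integral_const_mul_eq_inner]
    exact tendsto_const_nhds.inner h
  have hsq : Tendsto (fun i ↦ ∫ ω, f i ω ^ 2 ∂P) atTop (𝓝 (∫ ω, g ω ^ 2 ∂P)) := by
    have key (u : Lp ℝ 2 P) : ∫ ω, u ω ^ 2 ∂P = ⟪u, u⟫_ℝ := by
      rw [L2.inner_def]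
      simp [pow_two]
    simp_rw [key]
    exact h.inner h
  have hvar (c : ℝ) (u : Lp ℝ 2 P) : Var[fun ω ↦ c * u ω; P] =
      c ^ 2 * ∫ ω, u ω ^ 2 ∂P - (∫ ω, c * u ω ∂P) ^ 2 := by
    rw [variance_eq_sub ((Lp.memLp u).const_mul c)]
    simp [mul_pow, integral_const_mul]
  rw [hasGaussianLaw_iff_charFun_map_eq hg]
  intro t
  have h1 := ProbabilityMeasure.tendsto_iff_tendsto_charFun.1 hd.tendsto t
  refine tendsto_nhds_unique h1 ?_
  change Tendsto (fun i ↦ charFun (P.map (f i)) t) atTop _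
  rw [funext fun i ↦ (hf i).charFun_map_eq t]
  have hinner (u : Lp ℝ 2 P) : (fun ω ↦ ⟪t, u ω⟫_ℝ) = fun ω ↦ t * u ω := by
    ext ω; simp [mul_comm]
  simp_rw [hinner, hvar]
  have h2 := hmean t
  have h3 := ((hsq.const_mul (t ^ 2)).sub (h2.pow 2)).div_const 2
  have := (((Complex.continuous_ofReal.tendsto _).comp h2).mul_const Complex.I).sub
    ((Complex.continuous_ofReal.tendsto _).comp h3)
  simpa [Function.comp_def] using (Complex.continuous_exp.tendsto _).comp this

theorem IsGREWith.id_map {Ω : Type*} [MeasurableSpace Ω] {P : Measure Ω} {H : Type*}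
    [NormedAddCommGroup H] [InnerProductSpace ℝ H] [MeasurableSpace H] [BorelSpace H]
    [SecondCountableTopology H] {F : Ω → H} {C : H →L[ℝ] H} {m : H} (hF : IsGREWith F P m C) :
    IsGREWith id (P.map F) m C := by
  have hm := hF.isGaussianRandomElement.measurable
  have hmean : meanElement id (P.map F) = meanElement F P :=
    integral_map hm.aemeasurable (by fun_prop)
  refine ⟨⟨measurable_id, fun h ↦ ⟨?_⟩⟩, hmean.trans hF.mean_eq, fun h ↦ ?_⟩
  · rw [Measure.map_map (by fun_prop) hm]
    exact (hF.isGaussianRandomElement.hasGaussianLaw_inner h).isGaussian_map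
  · rw [← hF.covariance_eq, covarianceOp, covarianceOp, hmean,
      integral_map hm.aemeasurable (by fun_prop)]
    rfl

/-! ### Moments and finite-dimensional laws of Gaussian random elements. -/

section GRE

variable {Ω : Type*} [MeasurableSpace Ω] {P : Measure Ω} {H : Type*}
  [NormedAddCommGroup H] [InnerProductSpace ℝ H] [CompleteSpace H] {F : Ω → H}

theorem inner_integral_inner_smul (hF : MemLp F 2 P) (h g : H) :
    ⟪∫ ω, ⟪F ω, h⟫_ℝ • F ω ∂P, g⟫_ℝ = ∫ ω, ⟪F ω, h⟫_ℝ * ⟪F ω, g⟫_ℝ ∂P := by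
  have : Integrable (fun ω ↦ ⟪F ω, h⟫_ℝ • F ω) P :=
    memLp_one_iff_integrable.1 (hF.smul (hF.inner_const h))
  rw [real_inner_comm, ← integral_inner this]
  refine integral_congr_ae (.of_forall fun ω ↦ ?_)
  simp [inner_smul_right, real_inner_comm]

variable [MeasurableSpace H] [BorelSpace H]

/-- By Riesz, inner products exhaust the continuous functionals. The Gaussian law on `H` then
supplies second moments. -/
theorem IsGaussianRandomElement.hasGaussianLaw
    [IsProbabilityMeasure P] (hF : IsGaussianRandomElement F P) : HasGaussianLaw F P where
  isGaussian_map := by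
    refine isGaussian_of_isGaussian_map fun L ↦ ?_
    rw [Measure.map_map (by fun_prop) hF.measurable]
    obtain ⟨h, rfl⟩ := (InnerProductSpace.toDual ℝ H).surjective L
    convert (hF.hasGaussianLaw_inner h).isGaussian_map using 2
    ext ω
    simp [real_inner_comm]

variable {C : H →L[ℝ] H}

variable [SecondCountableTopology H] [IsProbabilityMeasure P]

theorem IsGREWith.integral_inner_eq_zero (hF : IsGREWith F P 0 C) (h : H) :
    ∫ ω, ⟪F ω, h⟫_ℝ ∂P = 0 := by
  have hL := hF.isGaussianRandomElement.hasGaussianLaw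
  simp_rw [real_inner_comm h]
  rw [integral_inner hL.integrable]
  change ⟪h, meanElement F P⟫_ℝ = 0
  simp [hF.mean_eq]

theorem IsGREWith.covariance_inner (hF : IsGREWith F P 0 C) (h g : H) :
    cov[fun ω ↦ ⟪F ω, h⟫_ℝ, fun ω ↦ ⟪F ω, g⟫_ℝ; P] = ⟪C h, g⟫_ℝ := by
  have hL := hF.isGaussianRandomElement.hasGaussianLaw.memLp_two
  rw [covariance_eq_sub (hL.inner_const h) (hL.inner_const g), hF.integral_inner_eq_zero,
    hF.integral_inner_eq_zero, ← hF.covariance_eq, covarianceOp, hF.mean_eq]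
  simp [inner_integral_inner_smul hL]

/-- The random variables `⟪F, v x⟫` of a centred Gaussian random element `F` form a centred Gaussian
process with covariance kernel `⟪C (v x), v y⟫`. -/
theorem IsGREWith.isCentredGPWithKernel {X : Type*} (hF : IsGREWith F P 0 C) (v : X → H) :
    IsCentredGPWithKernel (fun x ω ↦ ⟪F ω, v x⟫_ℝ) P fun x y ↦ ⟪C (v x), v y⟫_ℝ where
  isGaussianProcess := ⟨fun I ↦ by
    have h := hF.isGaussianRandomElement.hasGaussianLaw.map
      (ContinuousLinearMap.pi fun i : I ↦ innerSL ℝ (v i))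
    refine h.congr (.of_forall fun ω ↦ ?_)
    ext i
    simp [real_inner_comm]⟩
  mean_eq_zero x := hF.integral_inner_eq_zero (v x)
  covariance_eq x y := hF.covariance_inner (v x) (v y)

end GRE

/-! ### Construction of a Gaussian element with covariance `T* T`. -/

section Existence

/-- The adjoint of a Hilbert-Schmidt operator is Hilbert-Schmidt. -/
theorem HilbertBasis.summable_norm_adjoint_sq {H K ι κ : Type*} [NormedAddCommGroup H]
    [InnerProductSpace ℝ H] [CompleteSpace H] [NormedAddCommGroup K] [InnerProductSpace ℝ K]
    [CompleteSpace K] (b : HilbertBasis ι ℝ H) {e : κ → K} (he : Orthonormal ℝ e) {T : H →L[ℝ] K}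
    (hT : Summable fun i ↦ ‖T (b i)‖ ^ 2) :
    Summable fun j ↦ ‖ContinuousLinearMap.adjoint T (e j)‖ ^ 2 := by
  have hsum (j : κ) : HasSum (fun i ↦ ‖⟪e j, T (b i)⟫_ℝ‖ ^ 2)
      (‖ContinuousLinearMap.adjoint T (e j)‖ ^ 2) := by
    have := b.hasSum_inner_mul_inner (ContinuousLinearMap.adjoint T (e j))
      (ContinuousLinearMap.adjoint T (e j))
    rw [real_inner_self_eq_norm_sq] at this
    refine this.congr_fun fun i ↦ ?_
    rw [real_inner_comm _ (b i), ContinuousLinearMap.adjoint_inner_left, Real.norm_eq_abs, sq_abs,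
      sq]
  -- After exchanging the sums, Bessel for `e` bounds each term by `‖T (b i)‖ ^ 2`.
  refine summable_of_sum_le (c := ∑' i, ‖T (b i)‖ ^ 2) (fun _ ↦ by positivity) fun s ↦ ?_
  have hs := hasSum_sum fun j (_ : j ∈ s) ↦ hsum j
  exact hasSum_le (fun i ↦ he.sum_inner_products_le (T (b i))) hs hT.hasSum

/-- Vectors may vanish, so the orthogonal family consists of the spanned lines rather than of
normalised vectors. -/
theorem Summable.of_pairwise_inner_eq_zero {E ι : Type*} [NormedAddCommGroup E]
    [InnerProductSpace ℝ E] [CompleteSpace E] {v : ι → E} (hv : Pairwise fun i j ↦ ⟪v i, v j⟫_ℝ = 0)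
    (hs : Summable fun i ↦ ‖v i‖ ^ 2) : Summable v := by
  have hV : OrthogonalFamily ℝ (fun i ↦ Submodule.span ℝ {v i})
      fun i ↦ (Submodule.span ℝ {v i}).subtypeₗᵢ := by
    rintro i j hij ⟨x, hx⟩ ⟨y, hy⟩
    obtain ⟨a, rfl⟩ := Submodule.mem_span_singleton.1 hx
    obtain ⟨c, rfl⟩ := Submodule.mem_span_singleton.1 hy
    simp [inner_smul_left, inner_smul_right, hv hij]
  exact (hV.summable_iff_norm_sq_summable
    fun i ↦ ⟨v i, Submodule.mem_span_singleton_self (v i)⟩).2 hs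

/-- An orthonormal family of jointly Gaussian centred random variables. -/
structure IsOrthonormalGaussian {Ω κ : Type*} [MeasurableSpace Ω] (P : Measure Ω)
    (ξ : κ → Lp ℝ 2 P) : Prop where
  orthonormal : Orthonormal ℝ ξ
  integral_eq_zero : ∀ i, ∫ ω, ξ i ω ∂P = 0
  hasGaussianLaw_sum : ∀ (s : Finset κ) (c : κ → ℝ),
    HasGaussianLaw (∑ i ∈ s, c i • ξ i : Lp ℝ 2 P) P

theorem exists_isOrthonormalGaussian (κ : Type u) :
    ∃ (Ω : Type u) (_ : MeasurableSpace Ω) (P : Measure Ω) (_ : IsProbabilityMeasure P)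
      (ξ : κ → Lp ℝ 2 P), IsOrthonormalGaussian P ξ := by
  obtain ⟨Ω, mΩ, P, X, hXm, hX, hind, hP⟩ := exists_iid κ (gaussianReal 0 1)
  have hG (i : κ) : HasGaussianLaw (X i) P := (hX i).hasGaussianLaw
  have hL (i : κ) : MemLp (X i) 2 P := (hG i).memLp_two
  have hmean (i : κ) : ∫ ω, X i ω ∂P = 0 := by
    rw [(hX i).integral_eq, integral_id_gaussianReal]
  have hvar (i : κ) : Var[X i; P] = 1 := by
    rw [(hX i).variance_eq, variance_id_gaussianReal]; rfl
  have hin (i j : κ) : ⟪(hL i).toLp, (hL j).toLp⟫_ℝ = ∫ ω, X i ω * X j ω ∂P := by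
    rw [L2.inner_def]
    refine integral_congr_ae ?_
    filter_upwards [(hL i).coeFn_toLp, (hL j).coeFn_toLp] with ω h1 h2
    simp [h1, h2, mul_comm]
  refine ⟨Ω, mΩ, P, hP, fun i ↦ (hL i).toLp, ⟨⟨fun i ↦ ?_, fun i j hij ↦ ?_⟩, fun i ↦ ?_, ?_⟩⟩
  · have h := hin i i
    rw [real_inner_self_eq_norm_sq] at h
    have h2 := variance_of_integral_eq_zero (hXm i).aemeasurable (hmean i)
    simp_rw [← sq, ← h2, hvar] at h
    exact (pow_eq_one_iff_of_nonneg (norm_nonneg _) two_ne_zero).1 h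
  · change ⟪(hL i).toLp, (hL j).toLp⟫_ℝ = 0
    rw [hin]
    have := (hind.indepFun hij).integral_fun_mul_eq_mul_integral
      (hXm i).aestronglyMeasurable (hXm j).aestronglyMeasurable
    simp [this, hmean]
  · rw [integral_congr_ae (hL i).coeFn_toLp, hmean]
  · intro s c
    have h1 : HasGaussianLaw (fun ω (i : s) ↦ X i ω) P :=
      iIndepFun.hasGaussianLaw (X := fun i : s ↦ X i) (fun i ↦ hG i)
        (hind.precomp Subtype.val_injective)
    have h2 := h1.map_fun (∑ i : s, c i • ContinuousLinearMap.proj (R := ℝ) (φ := fun _ : s ↦ ℝ) i)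
    refine h2.congr ?_
    have h3 : ∀ᵐ ω ∂P, ∀ i ∈ s, (hL i).toLp (X i) ω = X i ω :=
      (Finset.eventually_all s).2 fun i _ ↦ (hL i).coeFn_toLp
    filter_upwards [Lp.coeFn_sum_smul (fun i ↦ (hL i).toLp) c s, h3] with ω h4 h5
    have h6 : ∑ i ∈ s, c i * (hL i).toLp (X i) ω = ∑ i ∈ s, c i * X i ω :=
      Finset.sum_congr rfl fun i hi ↦ by rw [h5 i hi]
    rw [h4, h6, ← Finset.sum_coe_sort s]
    simp

open ContinuousLinearMap in
theorem exists_isGREWith_adjoint_comp {H : Type w} {K : Type u} {ι : Type*} [NormedAddCommGroup H]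
    [InnerProductSpace ℝ H] [CompleteSpace H] [NormedAddCommGroup K] [InnerProductSpace ℝ K]
    [CompleteSpace K] [MeasurableSpace H] [BorelSpace H] [SecondCountableTopology H]
    (b : HilbertBasis ι ℝ H) {T : H →L[ℝ] K} (hT : Summable fun i ↦ ‖T (b i)‖ ^ 2) :
    ∃ P : Measure H, IsProbabilityMeasure P ∧ IsGREWith id P 0 (adjoint T ∘L T) := by
  obtain ⟨κ, e, -⟩ := exists_hilbertBasis ℝ K
  obtain ⟨Ω, mΩ, P, hP, ξ, hξ⟩ := exists_isOrthonormalGaussian κ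
  set w : κ → H := fun j ↦ adjoint T (e j)
  have hw : Summable fun j ↦ ‖w j‖ ^ 2 := b.summable_norm_adjoint_sq e.orthonormal hT
  let v : κ → Lp H 2 P := fun j ↦ (toSpanSingleton ℝ (w j)).compLpL 2 P (ξ j)
  have hv (j : κ) : v j =ᵐ[P] fun ω ↦ ξ j ω • w j := coeFn_compLpL _ _
  have hvv (i j : κ) : ⟪v i, v j⟫_ℝ = ⟪w i, w j⟫_ℝ * ⟪ξ i, ξ j⟫_ℝ := by
    rw [L2.inner_def, L2.inner_def, ← integral_const_mul]
    refine integral_congr_ae ?_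
    filter_upwards [hv i, hv j] with ω hi hj
    simp only [hi, hj, inner_smul_left, inner_smul_right, RCLike.inner_apply]
    simp
    ring
  have hvs : Summable v := by
    refine .of_pairwise_inner_eq_zero (fun i j hij ↦ ?_) (hw.congr fun j ↦ ?_)
    · simp [hvv, hξ.orthonormal.inner_eq_zero hij]
    · rw [← real_inner_self_eq_norm_sq (v j), hvv]
      simp [hξ.orthonormal.1 j]
  set F : Lp H 2 P := ∑' j, v j
  let Z (h : H) : Lp H 2 P →L[ℝ] Lp ℝ 2 P := (innerSL ℝ h).compLpL 2 P
  have hZ (h : H) : Z h F =ᵐ[P] fun ω ↦ ⟪F ω, h⟫_ℝ := by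
    filter_upwards [coeFn_compLpL (innerSL ℝ h) F] with ω hω
    rw [hω, innerSL_apply_apply, real_inner_comm]
  have hZv (h : H) (j : κ) : Z h (v j) = ⟪h, w j⟫_ℝ • ξ j := by
    refine Lp.ext ?_
    filter_upwards [coeFn_compLpL (innerSL ℝ h) (v j), hv j, Lp.coeFn_smul ⟪h, w j⟫_ℝ (ξ j)]
      with ω h1 h2 h3
    rw [h1, h2, h3]
    simp [mul_comm]
  have hsum (h : H) : HasSum (fun j ↦ ⟪h, w j⟫_ℝ • ξ j) (Z h F) := by
    simpa only [hZv] using hvs.hasSum.mapL (Z h)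
  have hgauss (h : H) : HasGaussianLaw (Z h F) P :=
    (isClosed_setOf_hasGaussianLaw P).mem_of_tendsto (hsum h)
      (.of_forall fun s ↦ hξ.hasGaussianLaw_sum s _)
  have hmean (h : H) : ∫ ω, Z h F ω ∂P = 0 := by
    have key (u : Lp ℝ 2 P) : ∫ ω, u ω ∂P = ⟪Lp.const 2 P (1 : ℝ), u⟫_ℝ := by
      simp [← L2.integral_const_mul_eq_inner]
    have h1 := (hsum h).mapL (innerSL ℝ (Lp.const 2 P (1 : ℝ)))
    rw [key]
    refine h1.unique ?_
    convert hasSum_zero with j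
    simp [← key, hξ.integral_eq_zero]
  have hξZ (g : H) (j : κ) : ⟪ξ j, Z g F⟫_ℝ = ⟪g, w j⟫_ℝ := by
    refine ((hsum g).mapL (innerSL ℝ (ξ j))).unique ?_
    convert hasSum_single j fun i hi ↦ ?_ using 1
    · simp [hξ.orthonormal.1 j]
    · simp [hξ.orthonormal.inner_eq_zero hi.symm]
  -- Both sides equal `∑ ⟪h, w j⟫ ⟪g, w j⟫`: the left by orthonormality of `ξ`, the right by
  -- Parseval for `e`.
  have hcov (h g : H) : ⟪Z h F, Z g F⟫_ℝ = ⟪T h, T g⟫_ℝ := by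
    refine ((hsum h).mapL (innerSL ℝ (Z g F))).unique ?_ |> fun h ↦ by
      rw [real_inner_comm]; exact h
    convert e.hasSum_inner_mul_inner (T h) (T g) using 2 with j
    simp only [innerSL_apply_apply, inner_smul_right, real_inner_comm (ξ j), hξZ, w,
      adjoint_inner_right]
    rw [real_inner_comm _ (T g)]
  have hFm : MemLp F 2 P := Lp.memLp F
  have hIm : meanElement F P = 0 := by
    refine ext_inner_left ℝ fun h ↦ ?_
    rw [meanElement, ← integral_inner (hFm.integrable (by norm_num)), inner_zero_right, ← hmean h]
    refine integral_congr_ae ?_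
    filter_upwards [hZ h] with ω hω
    rw [hω, real_inner_comm]
  have hF : IsGREWith F P 0 (adjoint T ∘L T) := by
    refine ⟨⟨(Lp.stronglyMeasurable F).measurable, fun h ↦ (hgauss h).congr (hZ h)⟩, hIm,
      fun h ↦ ext_inner_right ℝ fun g ↦ ?_⟩
    rw [covarianceOp, hIm, smul_zero, sub_zero, inner_integral_inner_smul hFm, comp_apply,
      adjoint_inner_left, ← hcov, L2.inner_def]
    refine integral_congr_ae ?_
    filter_upwards [hZ h, hZ g] with ω h1 h2
    simp [h1, h2, mul_comm]
  -- Taking the law of `F` makes `H` itself the sample space, which frees the result from the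
  -- universe of `K`.
  exact ⟨P.map F, Measure.isProbabilityMeasure_map hF.1.measurable.aemeasurable, hF.id_map⟩

end Existence

/-! ### The RKHS of a continuous kernel and its inclusion into `L²(ν)`. -/

section RKHS

variable {X : Type u} {k : X → X → ℝ} {H : Type w} [NormedAddCommGroup H] [InnerProductSpace ℝ H]
  [CompleteSpace H] [RKHS ℝ H X ℝ]

theorem RKHS.inner_kerFun_one (f : H) (x : X) : ⟪f, RKHS.kerFun H x (1 : ℝ)⟫_ℝ = f x := by
  simp

theorem IsRKHSOf.inner_kerFun (hH : IsRKHSOf H k) (x y : X) :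
    ⟪RKHS.kerFun H x (1 : ℝ), RKHS.kerFun H y (1 : ℝ)⟫_ℝ = k x y := by
  rw [RKHS.inner_kerFun_one, hH x]

variable [TopologicalSpace X]

theorem IsRKHSOf.continuous_kerFun (hH : IsRKHSOf H k)
    (hk : Continuous fun p : X × X ↦ k p.1 p.2) :
    Continuous fun x ↦ RKHS.kerFun H x (1 : ℝ) := by
  rw [continuous_iff_continuousAt]
  intro y
  rw [ContinuousAt, tendsto_iff_norm_sub_tendsto_zero]
  have key (x : X) : ‖RKHS.kerFun H x (1 : ℝ) - RKHS.kerFun H y (1 : ℝ)‖ =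
      √(k x x - 2 * k x y + k y y) := by
    rw [← Real.sqrt_sq (norm_nonneg _), norm_sub_sq_real, ← real_inner_self_eq_norm_sq,
      ← real_inner_self_eq_norm_sq]
    simp only [hH.inner_kerFun]
  simp_rw [key]
  have hc : Continuous fun x ↦ √(k x x - 2 * k x y + k y y) := by
    have h1 : Continuous fun x ↦ k x x := hk.comp (continuous_id.prodMk continuous_id)
    have h2 : Continuous fun x ↦ k x y := hk.comp (continuous_id.prodMk continuous_const)
    fun_prop
  convert hc.tendsto y using 2
  ring_nf
  simp

theorem IsRKHSOf.continuous_coe (hH : IsRKHSOf H k)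
    (hk : Continuous fun p : X × X ↦ k p.1 p.2) (f : H) : Continuous f := by
  have := (innerSL ℝ f).continuous.comp (hH.continuous_kerFun hk)
  refine this.congr fun x ↦ RKHS.inner_kerFun_one f x

/-- The kernel sections form a continuous image of a separable space, and their span is dense. -/
theorem IsRKHSOf.secondCountableTopology [TopologicalSpace.SeparableSpace X] (hH : IsRKHSOf H k)
    (hk : Continuous fun p : X × X ↦ k p.1 p.2) : SecondCountableTopology H := by
  have hsep := (TopologicalSpace.isSeparable_range (hH.continuous_kerFun hk)).span (R := ℝ)
    |>.closure
  have hspan : Submodule.span ℝ (Set.range fun x ↦ RKHS.kerFun H x (1 : ℝ)) =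
      Submodule.span ℝ {RKHS.kerFun H x v | (x) (v)} := by
    refine le_antisymm (Submodule.span_mono ?_) (Submodule.span_le.2 ?_)
    · rintro _ ⟨x, rfl⟩
      exact ⟨x, 1, rfl⟩
    · rintro _ ⟨x, v, rfl⟩
      have : RKHS.kerFun H x v = v • RKHS.kerFun H x (1 : ℝ) := by
        rw [← map_smul, smul_eq_mul, mul_one]
      rw [this]
      exact Submodule.smul_mem _ _ (Submodule.subset_span ⟨x, rfl⟩)
  rw [hspan, ← Submodule.topologicalClosure_coe, RKHS.kerFun_dense, Submodule.top_coe,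
    TopologicalSpace.isSeparable_univ_iff] at hsep
  exact UniformSpace.secondCountable_of_separable H

variable [CompactSpace X]

/-- The inclusion of the reproducing kernel Hilbert space of a continuous kernel on a compact space
into the continuous functions. -/
noncomputable def IsRKHSOf.toContinuousMap (hH : IsRKHSOf H k)
    (hk : Continuous fun p : X × X ↦ k p.1 p.2) : H →L[ℝ] C(X, ℝ) :=
  LinearMap.mkContinuousOfExistsBound
    { toFun f := ⟨f, hH.continuous_coe hk f⟩
      map_add' f g := by ext; simp
      map_smul' c f := by ext; simp } <| by
    obtain ⟨M, hM⟩ := (isCompact_range (hH.continuous_kerFun hk)).isBounded.exists_norm_le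
    refine ⟨max M 0, fun f ↦ (ContinuousMap.norm_le _ (by positivity)).2 fun x ↦ ?_⟩
    change ‖f x‖ ≤ _
    rw [← RKHS.inner_kerFun_one f x, mul_comm]
    exact (norm_inner_le_norm _ _).trans (mul_le_mul_of_nonneg_left
      ((hM _ ⟨x, rfl⟩).trans (le_max_left _ _)) (norm_nonneg _))

theorem IsRKHSOf.toContinuousMap_apply (hH : IsRKHSOf H k)
    (hk : Continuous fun p : X × X ↦ k p.1 p.2) (f : H) (x : X) :
    hH.toContinuousMap hk f x = f x := rfl

variable [MeasurableSpace X] [BorelSpace X] (ν : Measure X) [IsFiniteMeasure ν]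

/-- The inclusion of the reproducing kernel Hilbert space into `L²(ν)`. -/
noncomputable def IsRKHSOf.toL2 (hH : IsRKHSOf H k)
    (hk : Continuous fun p : X × X ↦ k p.1 p.2) : H →L[ℝ] Lp ℝ 2 ν :=
  ContinuousMap.toLp 2 ν ℝ ∘L hH.toContinuousMap hk

theorem IsRKHSOf.inner_toL2 (hH : IsRKHSOf H k) (hk : Continuous fun p : X × X ↦ k p.1 p.2)
    (f g : H) : ⟪hH.toL2 ν hk f, hH.toL2 ν hk g⟫_ℝ = ∫ x, f x * g x ∂ν := by
  rw [IsRKHSOf.toL2, ContinuousLinearMap.comp_apply, ContinuousLinearMap.comp_apply,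
    ContinuousMap.inner_toLp]
  simp [IsRKHSOf.toContinuousMap_apply, mul_comm]

theorem IsRKHSOf.integrable_mul (hH : IsRKHSOf H k) (hk : Continuous fun p : X × X ↦ k p.1 p.2)
    (f g : H) : Integrable (fun x ↦ f x * g x) ν :=
  ((hH.continuous_coe hk f).mul (hH.continuous_coe hk g)).integrable_of_hasCompactSupport
    (HasCompactSupport.of_compactSpace _)

theorem IsRKHSOf.summable_norm_toL2_sq (hH : IsRKHSOf H k)
    (hk : Continuous fun p : X × X ↦ k p.1 p.2) (hν : Integrable (fun x ↦ k x x) ν) {ι : Type*}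
    {b : ι → H} (hb : Orthonormal ℝ b) : Summable fun i ↦ ‖hH.toL2 ν hk (b i)‖ ^ 2 := by
  refine summable_of_sum_le (c := ∫ x, k x x ∂ν) (fun _ ↦ by positivity) fun s ↦ ?_
  simp_rw [← real_inner_self_eq_norm_sq, hH.inner_toL2 ν]
  rw [← integral_finsetSum s fun i _ ↦ hH.integrable_mul ν hk _ _]
  refine integral_mono (integrable_finsetSum s fun i _ ↦ hH.integrable_mul ν hk _ _) hν fun x ↦ ?_
  have := hb.sum_inner_products_le (RKHS.kerFun H x (1 : ℝ)) (s := s)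
  rw [← real_inner_self_eq_norm_sq, hH.inner_kerFun] at this
  simpa only [RKHS.inner_kerFun_one, Real.norm_eq_abs, sq_abs, ← sq] using this

/-- The covariance operator `f ↦ ∫ k(·, x) f(x) dν(x)`. -/
noncomputable def IsRKHSOf.integralOperator (hH : IsRKHSOf H k)
    (hk : Continuous fun p : X × X ↦ k p.1 p.2) : H →L[ℝ] H :=
  ContinuousLinearMap.adjoint (hH.toL2 ν hk) ∘L hH.toL2 ν hk

theorem IsRKHSOf.inner_integralOperator (hH : IsRKHSOf H k)
    (hk : Continuous fun p : X × X ↦ k p.1 p.2) (f g : H) :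
    ⟪hH.integralOperator ν hk f, g⟫_ℝ = ∫ x, f x * g x ∂ν := by
  rw [IsRKHSOf.integralOperator, ContinuousLinearMap.comp_apply,
    ContinuousLinearMap.adjoint_inner_left, hH.inner_toL2 ν]

end RKHS

/-! ### Assembly of the theorem. -/

theorem mainTheorem6 {X : Type u} [MetricSpace X] [CompactSpace X]
    [MeasurableSpace X] [BorelSpace X]
    (k : X → X → ℝ) (hk_pos : (Matrix.of k).PosSemidef)
    (hk_cont : Continuous (fun p : X × X ↦ k p.1 p.2))
    {H : Type w} [NormedAddCommGroup H] [InnerProductSpace ℝ H] [CompleteSpace H]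
    [RKHS ℝ H X ℝ] (hH : IsRKHSOf H k) [MeasurableSpace H] [BorelSpace H]
    (ν : Measure X) [IsProbabilityMeasure ν] [ν.IsOpenPosMeasure]
    (hν : Integrable (fun x ↦ k x x) ν) :
    ∃ C : H →L[ℝ] H,
      (∀ (f : H) (x : X), Integrable (fun x' ↦ k x x' * f x') ν ∧
        C f x = ∫ x', k x x' * f x' ∂ν) ∧
      (∃ (Ω : Type w) (_ : MeasurableSpace Ω) (P : Measure Ω) (_ : IsProbabilityMeasure P)
        (F : Ω → H), IsGREWith F P 0 C) ∧
      (∀ x x' : X, Integrable (fun z ↦ k x z * k z x') ν) ∧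
      (∀ (Ω : Type v) (_ : MeasurableSpace Ω) (P : Measure Ω) (_ : IsProbabilityMeasure P)
        (F : Ω → H), IsGREWith F P 0 C →
        IsCentredGPWithKernel (fun x ω ↦ ⟪F ω, RKHS.kerFun H x (1 : ℝ)⟫_ℝ) P
          (smoothedKernel k ν)) := by
  have : SecondCountableTopology H := hH.secondCountableTopology hk_cont
  -- Symmetry of `k` is inherited from the inner product of kernel sections.
  have hsymm (x y : X) : k x y = k y x := by
    rw [← hH.inner_kerFun, real_inner_comm, hH.inner_kerFun]
  refine ⟨hH.integralOperator ν hk_cont, fun f x ↦ ⟨?_, ?_⟩, ?_, fun x y ↦ ?_,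
    fun Ω _ P _ F hF ↦ ?_⟩
  · simpa only [hH x] using hH.integrable_mul ν hk_cont (RKHS.kerFun H x (1 : ℝ)) f
  · rw [← RKHS.inner_kerFun_one, hH.inner_integralOperator ν, hH x]
    simp_rw [mul_comm]
  · obtain ⟨ι, b, -⟩ := exists_hilbertBasis ℝ H
    obtain ⟨P, hP, hF⟩ := exists_isGREWith_adjoint_comp b
      (hH.summable_norm_toL2_sq ν hk_cont hν b.orthonormal)
    exact ⟨H, inferInstance, P, hP, id, hF⟩
  · have := hH.integrable_mul ν hk_cont (RKHS.kerFun H x (1 : ℝ)) (RKHS.kerFun H y (1 : ℝ))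
    simpa only [hH x, hH y, hsymm y] using this
  · have hr : smoothedKernel k ν = fun x y ↦ ⟪hH.integralOperator ν hk_cont
        (RKHS.kerFun H x (1 : ℝ)), RKHS.kerFun H y (1 : ℝ)⟫_ℝ := by
      ext x y
      simp only [smoothedKernel, hH.inner_integralOperator ν, hH x, hH y, hsymm y]
    rw [hr]
    exact hF.isCentredGPWithKernel _
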